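/- For real numbers $a, b$ let $\pi[a,b]$ denote the number of primes $p$ with $a \le p \le b$. Then for every positive integer $n$, $$\pi\left[n, \frac{9(n+3)}{8}\right] \ge 1,$$ that is, there is a prime $p$ with $n \le p \le \frac{9(n+3)}{8}$. -/

import Mathlib

/-- `primeCountIcc a b` is the number of primes in the closed real interval `[a, b]`,
written `π[a, b]`. (For real `a`, `b` this set is always finite, so `ncard` is its true size.) -/
noncomputable def primeCountIcc (a b : ℝ) : ℕ :=
  {p : ℕ | p.Prime ∧ (p : ℝ) ∈ Set.Icc a b}.ncard

/-- The set of primes in a bounded real interval is finite. -/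
theorem finite_primes_Icc (a b : ℝ) :
    {p : ℕ | p.Prime ∧ (p : ℝ) ∈ Set.Icc a b}.Finite :=
  (Set.finite_Iic ⌊b⌋₊).subset fun _ hp => Nat.le_floor hp.2.2

/-!
The interval `[n, 9 (n + 3) / 8]` contains a prime as soon as `θ` increases strictly on it, so it
suffices to bound `ψ(x) / x` above and below by constants whose quotient is less than `9 / 8`. This is
done by the method of Chebyshev and Sylvester, without the prime number theorem.

For rationals `ν d` with `∑ ν d / d = 0`, the Legendre–Chebyshev identity gives
`∑ ν d * log ⌊N / d⌋! = ∑ Λ(n) E(⌊N / n⌋)`, where `E(y) = ∑ ν d * ⌊y / d⌋` is periodic. By Stirling the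
left side is `a N + O(log N)` with `a = -∑ ν d * log d / d`, so a pointwise comparison of `E` with
step functions, which is a finite check over one period, turns into an inequality for `ψ`
(`logFactorialSum_add_psiSum_le`, `floorSum_add_stepSum_le_of_period`). Two choices of `ν` are used.

* With period `1260`, `E ≥ 1` on `[1, 36)` and `E ≥ 0` everywhere; the values `4 * ν d` are integers.
  Hence
  `ψ(N) ≤ 1.0277 N + O(log N) + ψ(N / 36)`, and iteration gives `psi_natCast_le`:
  `ψ(N) ≤ 1.0573 N + 2300`.
* With period `4620`, `E(y)` is at most `1` plus the number of `k ∈ {13, 17, 19, 41, 53}` with `k ≤ y`.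
  Hence `ψ(N) + ∑ ψ(N / k) ≥ 1.1973 N - O(log N)`, and the upper bound gives `le_psi_natCast`:
  `ψ(N) ≥ 0.9523 N - 12200`.

Since `9 / 8 * 0.9523 > 1.0573` and `ψ - θ` is of order `√x`, this settles `n ≥ 2000000`. Smaller `n`
are covered by `primeChain`, a chain of primes with sufficiently small gaps.

Signed combinations are encoded by two lists of pairs of natural numbers, one for the positive and
one for the negative coefficients, so that the finite checks take place in `ℕ`.
-/

/-! ### Logarithms of factorials -/

theorem mul_log_succ_sub_le_log_factorial (m : ℕ) :
    (m : ℝ) * Real.log (m + 1) - m ≤ Real.log (m.factorial : ℝ) := by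
  induction m with
  | zero => simp
  | succ m ih =>
    have hm : (0 : ℝ) < (m : ℝ) + 1 := by positivity
    rw [Nat.factorial_succ, Nat.cast_mul, Real.log_mul (by positivity) (by positivity)]
    push_cast
    have h := Real.log_le_sub_one_of_pos (x := ((m : ℝ) + 1 + 1) / (m + 1)) (by positivity)
    rw [Real.log_div (by positivity) hm.ne'] at h
    have h2 : ((m : ℝ) + 1 + 1) / (m + 1) - 1 = 1 / (m + 1) := by field_simp; ring
    rw [h2] at h
    have h3 := mul_le_mul_of_nonneg_left h hm.le
    rw [mul_one_div_cancel hm.ne'] at h3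
    linarith

theorem log_factorial_le {m : ℕ} (hm : 1 ≤ m) :
    Real.log (m.factorial : ℝ) ≤ m * Real.log m - m + 1 + Real.log m := by
  induction m, hm using Nat.le_induction with
  | base => simp
  | succ m hm ih =>
    have hm0 : (0 : ℝ) < (m : ℝ) := by exact_mod_cast hm
    rw [Nat.factorial_succ, Nat.cast_mul, Real.log_mul (by positivity) (by positivity)]
    push_cast
    have h := Real.one_sub_inv_le_log_of_pos (x := ((m : ℝ) + 1) / m) (by positivity)
    rw [Real.log_div (by positivity) hm0.ne'] at h
    have h2 : 1 - (((m : ℝ) + 1) / m)⁻¹ = 1 / (m + 1) := by field_simp; ring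
    rw [h2] at h
    have h3 := mul_le_mul_of_nonneg_left h (show (0 : ℝ) ≤ m + 1 by positivity)
    rw [mul_one_div_cancel (by positivity)] at h3
    linarith

/-- Stirling's approximation of `log ⌊t⌋!` at the rational point `t = N / d`, with an error that
does not depend on `d`. -/
theorem abs_log_factorial_div_sub_le {N d : ℕ} (hN : 1 ≤ N) (hd : 1 ≤ d) :
    |Real.log ((N / d).factorial : ℝ) - ((N : ℝ) / d * Real.log ((N : ℝ) / d) - (N : ℝ) / d)| ≤
      Real.log N + 1 := by
  have hN0 : (0 : ℝ) < N := by exact_mod_cast hN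
  have hd0 : (0 : ℝ) < d := by exact_mod_cast hd
  have hlogN : 0 ≤ Real.log N := Real.log_natCast_nonneg N
  set t : ℝ := (N : ℝ) / d with ht
  set m : ℕ := N / d with hm
  have ht0 : 0 < t := by positivity
  have hmt : (m : ℝ) ≤ t := Nat.cast_div_le
  have htm : t < m + 1 := by
    rw [ht, div_lt_iff₀ hd0]
    exact_mod_cast (by simpa [mul_comm] using Nat.lt_mul_div_succ N hd)
  have hmN : (m : ℝ) ≤ N := by exact_mod_cast Nat.div_le_self N d
  have hm1 : (0 : ℝ) ≤ m := by positivity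
  rw [abs_le]
  constructor
  · rcases Nat.eq_zero_or_pos m with h0 | hpos
    · have h := Real.log_le_sub_one_of_pos ht0
      have hlt : Real.log t ≤ 0 := by
        apply Real.log_nonpos ht0.le
        rw [h0] at htm; simpa using htm.le
      rw [h0]
      simp only [Nat.factorial_zero, Nat.cast_one, Real.log_one]
      nlinarith
    · have h1 := mul_log_succ_sub_le_log_factorial m
      have h2 : t * Real.log t ≤ t * Real.log (m + 1) :=
        mul_le_mul_of_nonneg_left (Real.log_le_log ht0 htm.le) ht0.le
      have h3 : 0 ≤ Real.log ((m : ℝ) + 1) := Real.log_nonneg (by linarith)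
      have h4 : Real.log ((m : ℝ) + 1) ≤ 1 + Real.log N := by
        have h5 : Real.log ((m : ℝ) + 1) ≤ Real.log (2 * N) := by
          apply Real.log_le_log (by positivity)
          have : (1 : ℝ) ≤ N := by exact_mod_cast hN
          linarith
        rw [Real.log_mul (by norm_num) hN0.ne'] at h5
        have := Real.log_two_lt_d9
        linarith
      nlinarith
  · rcases Nat.eq_zero_or_pos m with h0 | hpos
    · have h := Real.one_sub_inv_le_log_of_pos ht0
      have h2 := mul_le_mul_of_nonneg_left h ht0.le
      rw [mul_sub, mul_inv_cancel₀ ht0.ne'] at h2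
      rw [h0]
      simp only [Nat.factorial_zero, Nat.cast_one, Real.log_one]
      linarith
    · have hmpos : (0 : ℝ) < m := by exact_mod_cast hpos
      have h1 := log_factorial_le hpos
      have h := Real.one_sub_inv_le_log_of_pos (x := t / m) (by positivity)
      rw [Real.log_div ht0.ne' hmpos.ne', inv_div] at h
      have h2 := mul_le_mul_of_nonneg_left h ht0.le
      rw [mul_sub, mul_div_cancel₀ _ ht0.ne'] at h2
      have h3 : 0 ≤ (t - m) * Real.log m :=
        mul_nonneg (by linarith) (Real.log_natCast_nonneg m)
      have h4 : Real.log m ≤ Real.log N := Real.log_le_log hmpos hmN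
      nlinarith

/-! ### Comparison of factorial sums with sums of `ψ` -/

/-- `∑ v * ⌊y / d⌋` over the entries `(v, d)` of a list. -/
def floorSum (l : List (ℕ × ℕ)) (y : ℕ) : ℕ :=
  (l.map fun p => p.1 * (y / p.2)).sum

/-- The step function `∑ v * [k ≤ y]` over the entries `(v, k)` of a list. -/
def stepSum (l : List (ℕ × ℕ)) (y : ℕ) : ℕ :=
  (l.map fun p => if p.2 ≤ y then p.1 else 0).sum

/-- `∑ v * log ⌊N / d⌋!` over the entries `(v, d)` of a list. -/
noncomputable def logFactorialSum (l : List (ℕ × ℕ)) (N : ℕ) : ℝ :=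
  (l.map fun p => (p.1 : ℝ) * Real.log ((N / p.2).factorial : ℝ)).sum

/-- `∑ v * ψ ⌊N / k⌋` over the entries `(v, k)` of a list. -/
noncomputable def psiSum (l : List (ℕ × ℕ)) (N : ℕ) : ℝ :=
  (l.map fun p => (p.1 : ℝ) * Chebyshev.psi ((N / p.2 : ℕ) : ℝ)).sum

open ArithmeticFunction in
/-- The Legendre–Chebyshev identity `log N! = ∑ Λ(n) ⌊N / n⌋`. -/
theorem log_factorial_eq_sum_vonMangoldt (N : ℕ) :
    Real.log (N.factorial : ℝ) = ∑ n ∈ Finset.Ioc 0 N, vonMangoldt n * ((N / n : ℕ) : ℝ) := by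
  induction N with
  | zero => simp
  | succ N ih =>
    rw [Nat.factorial_succ, Nat.cast_mul, Real.log_mul (by positivity) (by positivity), ih,
      ← vonMangoldt_sum, Finset.sum_Ioc_succ_top (Nat.zero_le N)]
    have h1 : (N + 1).divisors = (Finset.Ioc 0 (N + 1)).filter (· ∣ N + 1) := by
      ext d; simp only [Nat.mem_divisors, Finset.mem_filter, Finset.mem_Ioc]
      constructor
      · rintro ⟨h, -⟩
        exact ⟨⟨Nat.pos_of_dvd_of_pos h N.succ_pos, Nat.le_of_dvd N.succ_pos h⟩, h⟩
      · rintro ⟨-, h⟩; exact ⟨h, N.succ_ne_zero⟩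
    rw [h1, Finset.sum_filter, Finset.sum_Ioc_succ_top (Nat.zero_le N), Nat.div_self N.succ_pos,
      if_pos dvd_rfl, add_right_comm, ← Finset.sum_add_distrib, Nat.cast_one, mul_one]
    congr 1
    refine Finset.sum_congr rfl fun n _ => ?_
    rw [Nat.succ_div]
    split_ifs <;> push_cast <;> ring

open ArithmeticFunction in
theorem log_factorial_div_eq_sum_vonMangoldt (N d : ℕ) :
    Real.log ((N / d).factorial : ℝ) =
      ∑ n ∈ Finset.Ioc 0 N, vonMangoldt n * ((N / n / d : ℕ) : ℝ) := by
  rw [log_factorial_eq_sum_vonMangoldt]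
  have hsub : Finset.Ioc 0 (N / d) ⊆ Finset.Ioc 0 N :=
    Finset.Ioc_subset_Ioc_right (Nat.div_le_self N d)
  rw [← Finset.sum_subset hsub]
  · refine Finset.sum_congr rfl fun n _ => ?_
    rw [Nat.div_div_eq_div_mul, Nat.div_div_eq_div_mul, mul_comm d n, mul_comm]
  · intro n hn hn'
    simp only [Finset.mem_Ioc, not_and, not_le] at hn hn'
    rw [Nat.div_div_eq_div_mul, mul_comm n d, ← Nat.div_div_eq_div_mul,
      Nat.div_eq_of_lt (hn' hn.1)]
    simp

open ArithmeticFunction in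
theorem psi_div_eq_sum_vonMangoldt (N : ℕ) {k : ℕ} (hk : 1 ≤ k) :
    Chebyshev.psi ((N / k : ℕ) : ℝ) =
      ∑ n ∈ Finset.Ioc 0 N, vonMangoldt n * (if k ≤ N / n then 1 else 0) := by
  rw [Chebyshev.psi, Nat.floor_natCast]
  simp only [mul_ite, mul_one, mul_zero]
  rw [← Finset.sum_filter]
  refine Finset.sum_congr ?_ fun _ _ => rfl
  ext n
  simp only [Finset.mem_Ioc, Finset.mem_filter]
  constructor
  · rintro ⟨h0, h⟩
    refine ⟨⟨h0, h.trans (Nat.div_le_self N k)⟩, ?_⟩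
    rw [Nat.le_div_iff_mul_le h0]
    rw [Nat.le_div_iff_mul_le hk] at h
    linarith
  · rintro ⟨⟨h0, -⟩, h⟩
    refine ⟨h0, ?_⟩
    rw [Nat.le_div_iff_mul_le h0] at h
    rw [Nat.le_div_iff_mul_le hk]
    linarith

open ArithmeticFunction in
theorem logFactorialSum_eq (l : List (ℕ × ℕ)) (N : ℕ) :
    logFactorialSum l N = ∑ n ∈ Finset.Ioc 0 N, vonMangoldt n * (floorSum l (N / n) : ℝ) := by
  induction l with
  | nil => simp [logFactorialSum, floorSum]
  | cons p l ih =>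
    simp only [logFactorialSum, floorSum, List.map_cons, List.sum_cons] at ih ⊢
    rw [ih, log_factorial_div_eq_sum_vonMangoldt, Finset.mul_sum, ← Finset.sum_add_distrib]
    refine Finset.sum_congr rfl fun n _ => ?_
    push_cast; ring

open ArithmeticFunction in
theorem psiSum_eq (l : List (ℕ × ℕ)) (hl : ∀ p ∈ l, 1 ≤ p.2) (N : ℕ) :
    psiSum l N = ∑ n ∈ Finset.Ioc 0 N, vonMangoldt n * (stepSum l (N / n) : ℝ) := by
  induction l with
  | nil => simp [psiSum, stepSum]
  | cons p l ih =>
    simp only [List.forall_mem_cons] at hl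
    have ih := ih hl.2
    simp only [psiSum, stepSum, List.map_cons, List.sum_cons] at ih ⊢
    rw [ih, psi_div_eq_sum_vonMangoldt N hl.1, Finset.mul_sum, ← Finset.sum_add_distrib]
    refine Finset.sum_congr rfl fun n _ => ?_
    push_cast; split_ifs <;> ring

/-- A pointwise inequality between floor sums and step functions, weighted by `Λ`, becomes an
inequality between factorial sums and values of `ψ`. -/
theorem logFactorialSum_add_psiSum_le {P Q U W : List (ℕ × ℕ)}
    (hU : ∀ p ∈ U, 1 ≤ p.2) (hW : ∀ p ∈ W, 1 ≤ p.2)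
    (h : ∀ y, 1 ≤ y → floorSum P y + stepSum U y ≤ floorSum Q y + stepSum W y) (N : ℕ) :
    logFactorialSum P N + psiSum U N ≤ logFactorialSum Q N + psiSum W N := by
  rw [logFactorialSum_eq, logFactorialSum_eq, psiSum_eq U hU, psiSum_eq W hW,
    ← Finset.sum_add_distrib, ← Finset.sum_add_distrib]
  refine Finset.sum_le_sum fun n hn => ?_
  rw [Finset.mem_Ioc] at hn
  rw [← mul_add, ← mul_add]
  refine mul_le_mul_of_nonneg_left ?_ ArithmeticFunction.vonMangoldt_nonneg
  exact_mod_cast h (N / n) (Nat.div_pos hn.2 hn.1)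

theorem stepSum_mono (l : List (ℕ × ℕ)) : Monotone (stepSum l) := by
  intro a b hab
  refine List.sum_le_sum fun p _ => ?_
  split_ifs <;> omega

theorem floorSum_add_mul (l : List (ℕ × ℕ)) {L : ℕ} (hl : ∀ p ∈ l, 1 ≤ p.2 ∧ p.2 ∣ L) (r q : ℕ) :
    floorSum l (r + L * q) = floorSum l r + floorSum l L * q := by
  induction l with
  | nil => simp [floorSum]
  | cons p l ih =>
    simp only [List.forall_mem_cons] at hl
    have ih := ih hl.2
    simp only [floorSum, List.map_cons, List.sum_cons] at ih ⊢
    obtain ⟨h1, c, rfl⟩ := hl.1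
    rw [ih, mul_assoc, Nat.add_mul_div_left _ _ h1, Nat.mul_div_cancel_left _ h1]
    ring

/-- The total weight `∑ v` over the entries `(v, d)` of a list. -/
def weight (l : List (ℕ × ℕ)) : ℕ := (l.map fun p => p.1).sum

/-- `∑ v / d` over the entries `(v, d)` of a list. -/
noncomputable def harmonicWeight (l : List (ℕ × ℕ)) : ℝ :=
  (l.map fun p => (p.1 : ℝ) / p.2).sum

/-- `∑ v * log d / d` over the entries `(v, d)` of a list. -/
noncomputable def logWeight (l : List (ℕ × ℕ)) : ℝ :=
  (l.map fun p => (p.1 : ℝ) / p.2 * Real.log p.2).sum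

theorem abs_logFactorialSum_sub_le (l : List (ℕ × ℕ)) (hl : ∀ p ∈ l, 1 ≤ p.2) {N : ℕ}
    (hN : 1 ≤ N) :
    |logFactorialSum l N - (N * (Real.log N - 1) * harmonicWeight l - N * logWeight l)| ≤
      weight l * (Real.log N + 1) := by
  induction l with
  | nil => simp [logFactorialSum, harmonicWeight, logWeight, weight]
  | cons p l ih =>
    simp only [List.forall_mem_cons] at hl
    have ih := ih hl.2
    simp only [logFactorialSum, harmonicWeight, logWeight, weight, List.map_cons,
      List.sum_cons] at ih ⊢
    have hN0 : (N : ℝ) ≠ 0 := by exact_mod_cast (by omega : N ≠ 0)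
    have hp0 : (p.2 : ℝ) ≠ 0 := by exact_mod_cast (by omega : p.2 ≠ 0)
    have h := abs_log_factorial_div_sub_le hN hl.1
    rw [Real.log_div hN0 hp0] at h
    rw [abs_le] at h ih ⊢
    have h1 := mul_le_mul_of_nonneg_left h.1 (Nat.cast_nonneg (α := ℝ) p.1)
    have h2 := mul_le_mul_of_nonneg_left h.2 (Nat.cast_nonneg (α := ℝ) p.1)
    have e : (p.1 : ℝ) * ((N : ℝ) / p.2 * (Real.log N - Real.log p.2) - (N : ℝ) / p.2) =
        N * (Real.log N - 1) * ((p.1 : ℝ) / p.2) - N * ((p.1 : ℝ) / p.2 * Real.log p.2) := by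
      ring
    rw [mul_sub, e] at h1 h2
    rw [Nat.cast_add]
    constructor <;> linarith [ih.1, ih.2]

/-- For denominators dividing `L`, an inequality between floor sums and step functions needs to be
checked only over one period, together with a comparison against the limiting weights. -/
theorem floorSum_add_stepSum_le_of_period {P Q U W : List (ℕ × ℕ)} {L : ℕ} (hL : 0 < L)
    (hP : ∀ p ∈ P, 1 ≤ p.2 ∧ p.2 ∣ L) (hQ : ∀ p ∈ Q, 1 ≤ p.2 ∧ p.2 ∣ L)
    (hPQ : floorSum P L = floorSum Q L)
    (h : ∀ r < L, floorSum P r + stepSum U r ≤ floorSum Q r + stepSum W r ∧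
      floorSum P r + weight U ≤ floorSum Q r + stepSum W L) (y : ℕ) :
    floorSum P y + stepSum U y ≤ floorSum Q y + stepSum W y := by
  rcases lt_or_ge y L with hy | hy
  · exact (h y hy).1
  · have hr := (h (y % L) (Nat.mod_lt y hL)).2
    have hU : stepSum U y ≤ weight U := by
      refine List.sum_le_sum fun p _ => ?_
      split_ifs <;> omega
    have hW := stepSum_mono W hy
    rw [← Nat.mod_add_div y L, floorSum_add_mul P hP, floorSum_add_mul Q hQ, hPQ,
      Nat.mod_add_div y L]
    omega

/-! ### The two schemes of denominators -/

/-- The positive coefficients, scaled by `4`, of the scheme of period `1260` that bounds `ψ` from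
above. Each entry `(v, d)` stands for `v * log ⌊N / d⌋!`. -/
def upperPos : List (ℕ × ℕ) :=
  [(4, 1), (4, 6), (4, 10), (2, 14), (2, 15), (2, 21), (2, 28), (4, 36), (6, 60), (2, 84),
   (8, 90), (4, 126), (2, 140), (8, 210)]

/-- The absolute values of the negative coefficients of the scheme of period `1260`. -/
def upperNeg : List (ℕ × ℕ) :=
  [(4, 2), (4, 3), (4, 5), (4, 7), (4, 12), (4, 18), (2, 20), (6, 30), (6, 42), (2, 45), (2, 63),
   (2, 70), (4, 105), (6, 180), (5, 252), (1, 315), (3, 420), (2, 630), (6, 1260)]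

/-- The positive coefficients of the scheme of period `4620` that bounds `ψ` from below. -/
def lowerPos : List (ℕ × ℕ) :=
  [(1, 1), (1, 6), (1, 10), (1, 14), (1, 15), (1, 21), (1, 33), (1, 55), (1, 140), (1, 154),
   (2, 210), (2, 330), (1, 770), (1, 1155), (4, 4620)]

/-- The absolute values of the negative coefficients of the scheme of period `4620`. -/
def lowerNeg : List (ℕ × ℕ) :=
  [(1, 2), (1, 3), (1, 5), (1, 7), (1, 11), (1, 28), (2, 30), (2, 42), (1, 66), (2, 70), (1, 77),
   (2, 105), (1, 132), (3, 165), (1, 220), (1, 231), (1, 308), (1, 420)]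


theorem upper_floorSum_ineq (y : ℕ) :
    floorSum upperNeg y + stepSum [(4, 1)] y ≤ floorSum upperPos y + stepSum [(4, 36)] y :=
  floorSum_add_stepSum_le_of_period (L := 1260) (by norm_num) (by decide) (by decide)
    (by decide +kernel) (by decide +kernel) y

/-- The finite check over one period of length `4620`, with residues written as `70 * a + b` so that
the depth of the kernel evaluation stays bounded. -/
theorem lower_floorSum_ineq_of_residue : ∀ a < 66, ∀ b < 70,
    floorSum lowerPos (70 * a + b) + stepSum [] (70 * a + b) ≤ floorSum lowerNeg (70 * a + b) +
      stepSum [(1, 1), (1, 13), (1, 17), (1, 19), (1, 41), (1, 53)] (70 * a + b) ∧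
    floorSum lowerPos (70 * a + b) + weight [] ≤ floorSum lowerNeg (70 * a + b) +
      stepSum [(1, 1), (1, 13), (1, 17), (1, 19), (1, 41), (1, 53)] 4620 := by
  decide +kernel

theorem lower_floorSum_ineq (y : ℕ) :
    floorSum lowerPos y + stepSum [] y ≤ floorSum lowerNeg y +
      stepSum [(1, 1), (1, 13), (1, 17), (1, 19), (1, 41), (1, 53)] y :=
  floorSum_add_stepSum_le_of_period (L := 4620) (by norm_num) (by decide) (by decide)
    (by decide +kernel) (fun r hr => by
      have h := lower_floorSum_ineq_of_residue (r / 70) (by omega) (r % 70) (by omega)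
      rwa [Nat.div_add_mod] at h) y

theorem four_mul_psi_le (N : ℕ) :
    4 * Chebyshev.psi N ≤ logFactorialSum upperPos N - logFactorialSum upperNeg N +
      4 * Chebyshev.psi ((N / 36 : ℕ) : ℝ) := by
  have h := logFactorialSum_add_psiSum_le (by decide) (by decide)
    (fun y _ => upper_floorSum_ineq y) N
  simp only [psiSum, List.map_cons, List.map_nil, List.sum_cons, List.sum_nil, Nat.div_one] at h
  push_cast at h ⊢
  linarith

theorem le_psi_add (N : ℕ) :
    logFactorialSum lowerPos N - logFactorialSum lowerNeg N ≤
      Chebyshev.psi N + Chebyshev.psi ((N / 13 : ℕ) : ℝ) + Chebyshev.psi ((N / 17 : ℕ) : ℝ) +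
        Chebyshev.psi ((N / 19 : ℕ) : ℝ) + Chebyshev.psi ((N / 41 : ℕ) : ℝ) +
        Chebyshev.psi ((N / 53 : ℕ) : ℝ) := by
  have h := logFactorialSum_add_psiSum_le (by decide) (by decide)
    (fun y _ => lower_floorSum_ineq y) N
  simp only [psiSum, List.map_cons, List.map_nil, List.sum_cons, List.sum_nil, Nat.div_one] at h
  push_cast at h ⊢
  linarith

/-! ### Numerical constants -/

/-- Bounds for `log 7` from those for smaller primes, as `7 ^ 4 = 2400 + 1` with `2400 = 2⁵ · 3 · 5²`. -/
theorem log_seven_bounds : 1.9458 < Real.log 7 ∧ Real.log 7 < 1.9461 := by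
  have h1 : Real.log 2400 = 5 * Real.log 2 + Real.log 3 + 2 * Real.log 5 := by
    rw [show (2400 : ℝ) = 2 ^ 5 * 3 * 5 ^ 2 by norm_num, Real.log_mul (by norm_num) (by norm_num),
      Real.log_mul (by norm_num) (by norm_num), Real.log_pow, Real.log_pow]
    norm_num
  have h2 : Real.log 2401 = 4 * Real.log 7 := by
    rw [show (2401 : ℝ) = 7 ^ 4 by norm_num, Real.log_pow]
    norm_num
  have h3 : Real.log 2400 ≤ Real.log 2401 := Real.log_le_log (by norm_num) (by norm_num)
  have h4 := Real.log_le_sub_one_of_pos (x := (2401 : ℝ) / 2400) (by norm_num)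
  rw [Real.log_div (by norm_num) (by norm_num)] at h4
  have := Real.log_two_gt_d9
  have := Real.log_two_lt_d9
  have := Real.log_three_gt_d9
  have := Real.log_three_lt_d9
  have := Real.log_five_gt_d9
  have := Real.log_five_lt_d9
  constructor <;> linarith

/-- A bound for `log 11` from those for smaller primes, as `11 ^ 2 = 120 + 1` with `120 = 2³ · 3 · 5`. -/
theorem log_eleven_gt : 2.3978 < Real.log 11 := by
  have h1 : Real.log 120 = 3 * Real.log 2 + Real.log 3 + Real.log 5 := by
    rw [show (120 : ℝ) = 2 ^ 3 * 3 * 5 by norm_num, Real.log_mul (by norm_num) (by norm_num),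
      Real.log_mul (by norm_num) (by norm_num), Real.log_pow]
    norm_num
  have h2 : Real.log 121 = 2 * Real.log 11 := by
    rw [show (121 : ℝ) = 11 ^ 2 by norm_num, Real.log_pow]
    norm_num
  have h4 := Real.one_sub_inv_le_log_of_pos (x := (121 : ℝ) / 120) (by norm_num)
  rw [Real.log_div (by norm_num) (by norm_num)] at h4
  have := Real.log_two_gt_d9
  have := Real.log_three_gt_d9
  have := Real.log_five_gt_d9
  linarith

/-- The logarithm of an `11`-smooth number in terms of the exponents of its prime factors. -/
theorem log_smooth (a b c d e : ℕ) :
    Real.log (2 ^ a * 3 ^ b * 5 ^ c * 7 ^ d * 11 ^ e) =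
      a * Real.log 2 + b * Real.log 3 + c * Real.log 5 + d * Real.log 7 + e * Real.log 11 := by
  rw [Real.log_mul (by positivity) (by positivity), Real.log_mul (by positivity) (by positivity),
    Real.log_mul (by positivity) (by positivity), Real.log_mul (by positivity) (by positivity)]
  simp only [Real.log_pow]

theorem logWeight_upper :
    logWeight upperNeg - logWeight upperPos = 499 / 315 * Real.log 2 + 529 / 420 * Real.log 3 +
      41 / 84 * Real.log 5 + 13 / 30 * Real.log 7 := by
  have h6 := log_smooth 1 1 0 0 0
  have h10 := log_smooth 1 0 1 0 0
  have h12 := log_smooth 2 1 0 0 0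
  have h14 := log_smooth 1 0 0 1 0
  have h15 := log_smooth 0 1 1 0 0
  have h18 := log_smooth 1 2 0 0 0
  have h20 := log_smooth 2 0 1 0 0
  have h21 := log_smooth 0 1 0 1 0
  have h28 := log_smooth 2 0 0 1 0
  have h30 := log_smooth 1 1 1 0 0
  have h36 := log_smooth 2 2 0 0 0
  have h42 := log_smooth 1 1 0 1 0
  have h45 := log_smooth 0 2 1 0 0
  have h60 := log_smooth 2 1 1 0 0
  have h63 := log_smooth 0 2 0 1 0
  have h70 := log_smooth 1 0 1 1 0
  have h84 := log_smooth 2 1 0 1 0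
  have h90 := log_smooth 1 2 1 0 0
  have h105 := log_smooth 0 1 1 1 0
  have h126 := log_smooth 1 2 0 1 0
  have h140 := log_smooth 2 0 1 1 0
  have h180 := log_smooth 2 2 1 0 0
  have h210 := log_smooth 1 1 1 1 0
  have h252 := log_smooth 2 2 0 1 0
  have h315 := log_smooth 0 2 1 1 0
  have h420 := log_smooth 2 1 1 1 0
  have h630 := log_smooth 1 2 1 1 0
  have h1260 := log_smooth 2 2 1 1 0
  norm_num at h6 h10 h12 h14 h15 h18 h20 h21 h28 h30 h36 h42 h45 h60 h63 h70 h84 h90 h105 h126 h140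
  norm_num at h180 h210 h252 h315 h420 h630 h1260
  simp only [logWeight, upperNeg, upperPos, List.map_cons, List.map_nil, List.sum_cons,
    List.sum_nil]
  push_cast
  simp only [Real.log_one,
    h6, h10, h12, h14, h15, h18, h20, h21, h28, h30, h36, h42, h45, h60, h63, h70, h84,
    h90, h105, h126, h140, h180, h210, h252, h315, h420, h630, h1260]
  ring

theorem logWeight_lower :
    logWeight lowerNeg - logWeight lowerPos = 179 / 462 * Real.log 2 + 13 / 70 * Real.log 3 +
      17 / 132 * Real.log 5 + 5 / 33 * Real.log 7 + 13 / 140 * Real.log 11 := by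
  have h6 := log_smooth 1 1 0 0 0
  have h10 := log_smooth 1 0 1 0 0
  have h14 := log_smooth 1 0 0 1 0
  have h15 := log_smooth 0 1 1 0 0
  have h21 := log_smooth 0 1 0 1 0
  have h28 := log_smooth 2 0 0 1 0
  have h30 := log_smooth 1 1 1 0 0
  have h33 := log_smooth 0 1 0 0 1
  have h42 := log_smooth 1 1 0 1 0
  have h55 := log_smooth 0 0 1 0 1
  have h66 := log_smooth 1 1 0 0 1
  have h70 := log_smooth 1 0 1 1 0
  have h77 := log_smooth 0 0 0 1 1
  have h105 := log_smooth 0 1 1 1 0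
  have h132 := log_smooth 2 1 0 0 1
  have h140 := log_smooth 2 0 1 1 0
  have h154 := log_smooth 1 0 0 1 1
  have h165 := log_smooth 0 1 1 0 1
  have h210 := log_smooth 1 1 1 1 0
  have h220 := log_smooth 2 0 1 0 1
  have h231 := log_smooth 0 1 0 1 1
  have h308 := log_smooth 2 0 0 1 1
  have h330 := log_smooth 1 1 1 0 1
  have h420 := log_smooth 2 1 1 1 0
  have h770 := log_smooth 1 0 1 1 1
  have h1155 := log_smooth 0 1 1 1 1
  have h4620 := log_smooth 2 1 1 1 1
  norm_num at h6 h10 h14 h15 h21 h28 h30 h33 h42 h55 h66 h70 h77 h105 h132 h140 h154 h165 h210 h220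
  norm_num at h231 h308 h330 h420 h770 h1155 h4620
  simp only [logWeight, lowerNeg, lowerPos, List.map_cons, List.map_nil, List.sum_cons,
    List.sum_nil]
  push_cast
  simp only [Real.log_one,
    h6, h10, h14, h15, h21, h28, h30, h33, h42, h55, h66, h70, h77, h105, h132, h140,
    h154, h165, h210, h220, h231, h308, h330, h420, h770, h1155, h4620]
  ring

theorem harmonicWeight_upper : harmonicWeight upperPos = harmonicWeight upperNeg := by
  simp only [harmonicWeight, upperNeg, upperPos, List.map_cons, List.map_nil, List.sum_cons,
    List.sum_nil]
  norm_num

theorem harmonicWeight_lower : harmonicWeight lowerPos = harmonicWeight lowerNeg := by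
  simp only [harmonicWeight, lowerNeg, lowerPos, List.map_cons, List.map_nil, List.sum_cons,
    List.sum_nil]
  norm_num

theorem logFactorialSum_upper_le {N : ℕ} (hN : 1 ≤ N) :
    logFactorialSum upperPos N - logFactorialSum upperNeg N ≤
      4.1107 * N + 125 * (Real.log N + 1) := by
  have h1 := (abs_le.1 (abs_logFactorialSum_sub_le upperPos (by decide) hN)).2
  have h2 := (abs_le.1 (abs_logFactorialSum_sub_le upperNeg (by decide) hN)).1
  rw [show weight upperPos = 54 by decide] at h1
  rw [show weight upperNeg = 71 by decide] at h2
  rw [harmonicWeight_upper] at h1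
  have h3 : logWeight upperNeg - logWeight upperPos ≤ 4.1107 := by
    rw [logWeight_upper]
    linarith [Real.log_two_lt_d9, Real.log_three_lt_d9, Real.log_five_lt_d9, log_seven_bounds.2]
  have h4 := mul_le_mul_of_nonneg_left h3 (Nat.cast_nonneg (α := ℝ) N)
  push_cast at h1 h2
  linarith

theorem le_logFactorialSum_lower {N : ℕ} (hN : 1 ≤ N) :
    1.1973 * N - 44 * (Real.log N + 1) ≤
      logFactorialSum lowerPos N - logFactorialSum lowerNeg N := by
  have h1 := (abs_le.1 (abs_logFactorialSum_sub_le lowerPos (by decide) hN)).1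
  have h2 := (abs_le.1 (abs_logFactorialSum_sub_le lowerNeg (by decide) hN)).2
  rw [show weight lowerPos = 20 by decide] at h1
  rw [show weight lowerNeg = 24 by decide] at h2
  rw [harmonicWeight_lower] at h1
  have h3 : 1.1973 ≤ logWeight lowerNeg - logWeight lowerPos := by
    rw [logWeight_lower]
    linarith [Real.log_two_gt_d9, Real.log_three_gt_d9, Real.log_five_gt_d9, log_seven_bounds.1,
      log_eleven_gt]
  have h4 := mul_le_mul_of_nonneg_left h3 (Nat.cast_nonneg (α := ℝ) N)
  push_cast at h1 h2
  linarith

/-! ### Explicit linear bounds for `ψ` -/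

/-- The tangent to `log` at `2 ^ 20`, which lies above `log`. -/
theorem log_le_tangent {x : ℝ} (hx : 0 < x) : Real.log x ≤ x / 2 ^ 20 + 12.87 := by
  have h := Real.log_le_sub_one_of_pos (x := x / 2 ^ 20) (by positivity)
  rw [Real.log_div hx.ne' (by positivity), Real.log_pow] at h
  have := Real.log_two_lt_d9
  push_cast at h
  linarith

theorem psi_le_add_psi_div {N : ℕ} (hN : 1 ≤ N) :
    Chebyshev.psi N ≤ 1.02771 * N + 434 + Chebyshev.psi ((N / 36 : ℕ) : ℝ) := by
  have h1 := four_mul_psi_le N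
  have h2 := logFactorialSum_upper_le hN
  have hN0 : (0 : ℝ) < N := by exact_mod_cast hN
  have h3 := log_le_tangent hN0
  linarith

/-- Iteration of `psi_le_add_psi_div`: each division by `36` lowers `log N` by at least `3`, so about
`log N / 3` steps occur, each of which contributes the constant `434`. -/
theorem psi_le_mul_add_log (N : ℕ) (hN : 1 ≤ N) :
    Chebyshev.psi N ≤ 1.0571 * N + 434 * (1 + Real.log N / 3) := by
  induction N using Nat.strong_induction_on with
  | _ N ih =>
    have h1 := psi_le_add_psi_div hN
    have hN0 : (0 : ℝ) < N := by exact_mod_cast hN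
    rcases lt_or_ge N 36 with h36 | h36
    · rw [Nat.div_eq_of_lt h36, Nat.cast_zero, Chebyshev.psi_zero] at h1
      have := Real.log_natCast_nonneg N
      linarith
    · have hm : 1 ≤ N / 36 := Nat.div_pos h36 (by norm_num)
      have h2 := ih (N / 36) (Nat.div_lt_self hN (by norm_num)) hm
      have h3 : ((N / 36 : ℕ) : ℝ) ≤ (N : ℝ) / 36 := by
        simpa using Nat.cast_div_le (α := ℝ) (m := N) (n := 36)
      have h4 : Real.log ((N / 36 : ℕ) : ℝ) ≤ Real.log N - 3 := by
        have h5 := Real.log_le_log (by exact_mod_cast hm) h3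
        rw [Real.log_div hN0.ne' (by norm_num), show (36 : ℝ) = 2 ^ 2 * 3 ^ 2 by norm_num,
          Real.log_mul (by norm_num) (by norm_num), Real.log_pow, Real.log_pow] at h5
        push_cast at h5
        linarith [Real.log_two_gt_d9, Real.log_three_gt_d9]
      linarith

theorem psi_natCast_le (N : ℕ) : Chebyshev.psi N ≤ 1.0573 * N + 2300 := by
  rcases Nat.eq_zero_or_pos N with rfl | hN
  · simp [Chebyshev.psi_zero]
  · have h1 := psi_le_mul_add_log N hN
    have hN0 : (0 : ℝ) < N := by exact_mod_cast hN
    have h2 := log_le_tangent hN0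
    linarith

theorem psi_le_linear {x : ℝ} (hx : 0 ≤ x) : Chebyshev.psi x ≤ 1.0573 * x + 2300 := by
  rw [Chebyshev.psi_eq_psi_coe_floor]
  linarith [psi_natCast_le ⌊x⌋₊, Nat.floor_le hx]

theorem psi_div_le (N k : ℕ) :
    Chebyshev.psi ((N / k : ℕ) : ℝ) ≤ 1.0573 * ((N : ℝ) / k) + 2300 := by
  linarith [psi_natCast_le (N / k), Nat.cast_div_le (α := ℝ) (m := N) (n := k)]

theorem le_psi_natCast {N : ℕ} (hN : 1 ≤ N) : 0.9523 * N - 12200 ≤ Chebyshev.psi N := by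
  have h1 := le_psi_add N
  have h2 := le_logFactorialSum_lower hN
  have hN0 : (0 : ℝ) < N := by exact_mod_cast hN
  have h3 := log_le_tangent hN0
  have h13 := psi_div_le N 13
  have h17 := psi_div_le N 17
  have h19 := psi_div_le N 19
  have h41 := psi_div_le N 41
  have h53 := psi_div_le N 53
  push_cast at h13 h17 h19 h41 h53
  linarith

/-! ### Primes in `[n, 9 (n + 3) / 8]` -/

theorem le_theta_natCast {N : ℕ} (hN : 1 ≤ N) : 0.9515 * N - 22400 ≤ Chebyshev.theta N := by
  have hN1 : (1 : ℝ) ≤ N := by exact_mod_cast hN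
  have h1 := le_psi_natCast hN
  have h2 := Chebyshev.psi_sub_theta_le_psi_add_psi_add_psi (N : ℝ)
  have hmono : ∀ a : ℝ, a ≤ 1 / 2 → Chebyshev.psi ((N : ℝ) ^ a) ≤ 1.0573 * √N + 2300 := by
    intro a ha
    have h3 := psi_le_linear (x := (N : ℝ) ^ a) (by positivity)
    have h4 : (N : ℝ) ^ a ≤ √N := by
      rw [Real.sqrt_eq_rpow]
      exact Real.rpow_le_rpow_of_exponent_le hN1 ha
    linarith
  have ha := hmono (2 : ℝ)⁻¹ (by norm_num)
  have hb := hmono (3 : ℝ)⁻¹ (by norm_num)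
  have hc := hmono (5 : ℝ)⁻¹ (by norm_num)
  -- the arithmetic–geometric mean inequality for `N / 2000` and `2000`
  have hs : √(N : ℝ) ≤ N / 4000 + 1000 := by
    have h5 := Real.sq_sqrt (show (0 : ℝ) ≤ N by positivity)
    nlinarith [sq_nonneg (√(N : ℝ) - 2000)]
  linarith

theorem exists_prime_of_theta_lt {m n : ℕ} (h : Chebyshev.theta m < Chebyshev.theta n) :
    ∃ p, p.Prime ∧ m < p ∧ p ≤ n := by
  by_contra! hcon
  refine h.not_ge ?_
  rw [Chebyshev.theta, Chebyshev.theta, Nat.floor_natCast, Nat.floor_natCast]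
  refine Finset.sum_le_sum_of_subset_of_nonneg ?_ fun p _ _ => Real.log_natCast_nonneg p
  intro p hp
  simp only [Finset.mem_filter, Finset.mem_Ioc] at hp ⊢
  refine ⟨⟨hp.1.1, ?_⟩, hp.2⟩
  by_contra! hlt
  exact absurd hp.1.2 (hcon p hp.2 hlt).not_ge

theorem exists_prime_of_large {n : ℕ} (hn : 2000000 ≤ n) :
    ∃ p, p.Prime ∧ n ≤ p ∧ 8 * p ≤ 9 * (n + 3) := by
  obtain ⟨p, hp, h1, h2⟩ := exists_prime_of_theta_lt (m := n) (n := 9 * (n + 3) / 8) (by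
    have h3 := le_theta_natCast (N := 9 * (n + 3) / 8) (by omega)
    have h4 := (Chebyshev.theta_le_psi n).trans (psi_natCast_le n)
    have h5 : 9 * (n : ℝ) ≤ 8 * ((9 * (n + 3) / 8 : ℕ) : ℝ) := by
      exact_mod_cast (by omega : 9 * n ≤ 8 * (9 * (n + 3) / 8))
    have h6 : (2000000 : ℝ) ≤ n := by exact_mod_cast hn
    linarith)
  exact ⟨p, hp, h1.le, by omega⟩

/-- If consecutive members `p`, `q` of a list of primes satisfy `8 * q ≤ 9 * (p + 4)`, then a number
`n` above the first member and up to the last has a prime in `[n, 9 (n + 3) / 8]`: the first member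
`q ≥ n` is one, because `n ≥ p + 1`. -/
theorem exists_prime_of_isChain {n : ℕ} (l : List ℕ) (p : ℕ) (hl : ∀ q ∈ l, q.Prime)
    (hc : List.IsChain (fun p q => 8 * q ≤ 9 * (p + 4)) (p :: l)) (hp : p < n)
    (hn : n ≤ l.getLastD p) : ∃ q, q.Prime ∧ n ≤ q ∧ 8 * q ≤ 9 * (n + 3) := by
  induction l generalizing p with
  | nil => exact absurd hp hn.not_gt
  | cons q l ih =>
    rw [List.isChain_cons_cons] at hc
    rw [List.forall_mem_cons] at hl
    rcases le_or_gt n q with hnq | hnq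
    · exact ⟨q, hl.1, hnq, by omega⟩
    · exact ih q hl.2 hc.2 hnq (by rwa [List.getLastD_cons] at hn)

/-- Primes, starting with `5`, each of which is the largest prime `q` with `8 * q ≤ 9 * (p + 4)`,
where `p` is the preceding member, or `2` for the first. -/
def primeChain : List ℕ :=
  [5, 7, 11, 13, 19, 23, 29, 37, 43, 47, 53, 61, 73, 83, 97, 113, 131, 151, 173, 199, 227,
   257, 293, 331, 373, 421, 467, 523, 587, 661, 743, 839, 947, 1069, 1201, 1327, 1493, 1669,
   1879, 2113, 2381, 2683, 3019, 3391, 3803, 4273, 4801, 5399, 6073, 6833, 7691, 8647, 9721,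
   10939, 12301, 13841, 15569, 17519, 19709, 22171, 24943, 28057, 31567, 35509, 39937, 44927,
   50543, 56857, 63949, 71947, 80933, 91033, 102409, 115211, 129607, 145807, 164023, 184523,
   207589, 233509, 262697, 295517, 332461, 374009, 420757, 473353, 532523, 599087, 673961,
   758203, 852959, 959579, 1079527, 1214471, 1366279, 1537061, 1729193, 1945337, 2188493]

theorem prime_of_mem_primeChain : ∀ q ∈ primeChain, q.Prime := by
  simp only [primeChain, List.forall_mem_cons]
  norm_num

theorem exists_prime_of_small {n : ℕ} (h0 : 0 < n) (hn : n ≤ 2000000) :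
    ∃ p, p.Prime ∧ n ≤ p ∧ 8 * p ≤ 9 * (n + 3) := by
  rcases le_or_gt n 2 with h2 | h2
  · exact ⟨2, Nat.prime_two, h2, by omega⟩
  · exact exists_prime_of_isChain primeChain 2 prime_of_mem_primeChain (by decide +kernel) h2
      (hn.trans (by decide +kernel))

theorem mainTheorem1 (n : ℕ) (hn : 0 < n) :
    1 ≤ primeCountIcc (n : ℝ) (9 * ((n : ℝ) + 3) / 8) := by
  have h : ∃ p, p.Prime ∧ n ≤ p ∧ 8 * p ≤ 9 * (n + 3) := by
    rcases le_total n 2000000 with h | h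
    · exact exists_prime_of_small hn h
    · exact exists_prime_of_large h
  obtain ⟨p, hp, hnp, hpn⟩ := h
  rw [primeCountIcc, Nat.one_le_iff_ne_zero]
  refine Set.ncard_ne_zero_of_mem (a := p) ⟨hp, ?_, ?_⟩ (finite_primes_Icc _ _)
  · exact_mod_cast hnp
  · have : (8 : ℝ) * p ≤ 9 * (n + 3) := by exact_mod_cast hpn
    linarith
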